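/- Let $k\ge 1$ and $n\ge 1$ be integers. A closed walk on the complete graph on a vertex set is called a $k$-tour if the graph formed by the vertices it visits and the edges it traverses is a tree, and the walk crosses each edge of this tree exactly $2k$ times (equivalently, $k$ times in each direction). Let $c_n^{(k)}$ be the number of $k$-tours on trees with $n+1$ vertices, where two $k$-tours (regarded as sequences of vertices with a distinguished starting vertex) are identified if they differ only by a relabelling of the vertices. Then $$ c_n^{(k)}=\sum_{\ell=1}^{n}\ \sum_{(n_0,n_1,\dots,n_{n-1})\in T_n(\ell)}\frac{\ell}{n}\binom{n}{n_0,n_1,\dots,n_{n-1}}\,\frac{1}{\ell!}\binom{\ell k}{k,k,\dots,k}\prod_{i=1}^{n-1}\left(\frac{1}{(i+1)!}\binom{(i+1)k}{k,k,\dots,k}\right)^{n_i}, $$ where $$ T_n(\ell)=\Big\{(n_0,n_1,\dots,n_{n-1})\in(\mathbb Z_{\ge 0})^{n}\ :\ \sum_{i=0}^{n-1}n_i=n,\ \ \sum_{i=0}^{n-1}i\,n_i=n-\ell\Big\}. $$ -/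

import Mathlib

namespace HypergraphCatalan

/-- A closed walk `W` on the complete graph on `V` is a tree walk if the graph `T(W)`, formed by
the vertices visited and the edges traversed by `W`, is a tree. -/
def IsTreeWalk {V : Type*} {v : V} (W : (⊤ : SimpleGraph V).Walk v v) : Prop :=
  W.toSubgraph.coe.IsTree

open Classical in
/-- A `k`-tour is a tree walk `W` which crosses every edge of `T(W)` exactly `2k` times (`W` being
closed and `T(W)` a tree, this means `k` times in each direction). -/
def IsKTour {V : Type*} (k : ℕ) {v : V} (W : (⊤ : SimpleGraph V).Walk v v) : Prop :=
  IsTreeWalk W ∧ ∀ e ∈ W.toSubgraph.edgeSet, W.edges.count e = 2 * k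

/-- The `k`-tours on labelled trees with vertex set `{0, …, n}`, with arbitrary starting vertex:
the tree `T(W)` has all the `n + 1` labels as its vertices. -/
structure LabelledKTour (k n : ℕ) where
  root : Fin (n + 1)
  walk : (⊤ : SimpleGraph (Fin (n + 1))).Walk root root
  isKTour : IsKTour k walk
  spanning : walk.toSubgraph.IsSpanning

/-- Two `k`-tours are isomorphic if a relabelling of the vertices carries the sequence of vertices
of the first one to that of the second one. -/
def tourSetoid (k n : ℕ) : Setoid (LabelledKTour k n) where
  r W W' := ∃ σ : Equiv.Perm (Fin (n + 1)), W'.walk.support = W.walk.support.map σ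
  iseqv :=
    { refl := fun W => ⟨1, by simp⟩
      symm := by
        rintro W W' ⟨σ, h⟩
        exact ⟨σ⁻¹, by simp [h]⟩
      trans := by
        rintro W W' W'' ⟨σ, h⟩ ⟨τ, h'⟩
        exact ⟨τ * σ, by simp [h, h']⟩ }

/-- The hypergraph Catalan number `c_n^{(k)}`: the number of `k`-tours on trees with `n + 1`
vertices, where (as usual for unlabelled objects) isomorphic tours are identified. -/
noncomputable def hypergraphCatalan (k n : ℕ) : ℕ :=
  Nat.card (Quotient (tourSetoid k n))

/-- The set `T_n(ℓ)` of the tuples `(n_0, …, n_{n-1})` of non-negative integers with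
`∑ n_i = n` and `∑ i n_i = n - ℓ`. -/
def degreeSequences (n l : ℕ) : Finset (Fin n → ℕ) :=
  {d ∈ Finset.piAntidiag Finset.univ n | (∑ i : Fin n, ((i : ℕ) : ℤ) * d i) = (n : ℤ) - l}

theorem mem_degreeSequences {n l : ℕ} {d : Fin n → ℕ} :
    d ∈ degreeSequences n l ↔
      ∑ i, d i = n ∧ (∑ i : Fin n, ((i : ℕ) : ℤ) * d i) = (n : ℤ) - l := by
  simp [degreeSequences]

/-- The multinomial coefficient `(m k; k, …, k)` with `m` lower entries equal to `k`. -/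
def equalMultinomial (m k : ℕ) : ℕ :=
  Nat.multinomial (Finset.univ : Finset (Fin m)) fun _ => k

end HypergraphCatalan

/-! A tour is encoded by its exit words: for each vertex, the sequence of neighbours to which the
walk moves on leaving it. At a non-root vertex with `i` children the word has `k` letters for the
parent and `k` for each child, and it ends with the parent. Up to naming the children, such a word
is a partition of `(i+1)k` positions into `i+1` blocks of size `k`, the parent owning the block of
the last position; this gives `((i+1)k)! / ((i+1)! k!^(i+1))` words. At a root with `ℓ` children the
count is `(ℓk)! / (ℓ! k!^ℓ)`. With `n_i` non-root vertices having `i` children, the factor `ℓ/n`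
times the multinomial coefficient counts the plane forests below the root, by Lagrange inversion.

Instead of decomposing tours, the proof guesses the number of completions of any partial tour and
checks the one-step recursion. The guess `potential` multiplies local series of remaining exit words
over the seen vertices, `X` marking children still to be discovered, and applies `fillSlots`, which
is `Q ↦ (M-1)! [X^(M-1)] Q' φ^M` for `M ≥ 1` unseen vertices and `φ = childSeries k`. Here
`localSeries_succ` removes one letter of an exit word and `fillSlots_X_mul` fills one slot; together
they give `Valid.potential_eq`, and induction gives `Valid.card_runs`.

Allowed step sequences are then matched with labelled tours (`exists_tour_of_mem_runs`,
`Tracks.support_mem_runs`). Relabelling acts freely, so division by `(n+1)!` gives the unlabelled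
count, and expanding the coefficients gives the formula. -/

namespace HypergraphCatalan

/-! ### Exit words at a single vertex -/

open Finset PowerSeries

/-- The exponential count of exit words at a vertex: `u` remaining visits of the parent (the last
letter being one of them), and remaining visits of the known children with total `R` and product of
factorials `S`; the variable marks the children that are still to be discovered. -/
noncomputable def localSeries (k : ℕ) : ℕ → ℕ → ℚ → ℚ⟦X⟧
  | 0, R, _ => if R = 0 then 1 else 0
  | q + 1, R, S => PowerSeries.mk fun j =>
      ((q + R + j * k).factorial : ℚ) / (j.factorial * (k.factorial : ℚ) ^ j * q.factorial * S)

/-- The series of exit words at a vertex that has just been discovered. -/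
noncomputable def childSeries (k : ℕ) : ℚ⟦X⟧ := localSeries k k 0 1

/-- Split the exit words by their next letter: the parent, a known child with visits left, or a new
child. If `N = q + R + j * k` letters precede the final one, the three cases contribute `q`, `R` and
`j * k` times `(N-1)!` over a common denominator, and these add up to `N!`. -/
theorem localSeries_succ {ι : Type*} [DecidableEq ι] {k : ℕ} (hk : 1 ≤ k) (q : ℕ) (s : Finset ι)
    (f : ι → ℕ) :
    localSeries k (q + 1) (∑ c ∈ s, f c) (∏ c ∈ s, ((f c).factorial : ℚ)) =
      localSeries k q (∑ c ∈ s, f c) (∏ c ∈ s, ((f c).factorial : ℚ)) +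
      ∑ c ∈ s.filter (fun c => 0 < f c),
        localSeries k (q + 1) (∑ c ∈ s, f c - 1) ((∏ c ∈ s, ((f c).factorial : ℚ)) / f c) +
      X * localSeries k (q + 1) (∑ c ∈ s, f c + (k - 1))
        ((∏ c ∈ s, ((f c).factorial : ℚ)) * (k - 1).factorial) := by
  have hS : (∏ c ∈ s, ((f c).factorial : ℚ)) ≠ 0 :=
    prod_ne_zero_iff.2 fun c _ => by exact_mod_cast (f c).factorial_ne_zero
  have hsum : (∑ c ∈ s.filter (fun c => 0 < f c), (f c : ℚ)) = ((∑ c ∈ s, f c : ℕ) : ℚ) := by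
    push_cast
    refine sum_subset (filter_subset _ _) fun c hc hc' => ?_
    simp only [mem_filter, hc, true_and, not_lt, Nat.le_zero] at hc'
    simp [hc']
  have hRS : ∑ c ∈ s, f c = 0 → (∏ c ∈ s, ((f c).factorial : ℚ)) = 1 := fun h =>
    prod_eq_one fun c hc => by simp [sum_eq_zero_iff.1 h c hc]
  generalize (∏ c ∈ s, ((f c).factorial : ℚ)) = S at hS hRS ⊢
  have hfil : ∀ c ∈ s.filter (fun c => 0 < f c), 0 < ∑ c ∈ s, f c := fun c hc => by
    rw [mem_filter] at hc
    exact hc.2.trans_le (single_le_sum (f := f) (fun _ _ => Nat.zero_le _) hc.1)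
  have hterm : ∀ j : ℕ, coeff j (∑ c ∈ s.filter (fun c => 0 < f c),
        localSeries k (q + 1) (∑ c ∈ s, f c - 1) (S / f c)) =
      ((∑ c ∈ s, f c : ℕ) : ℚ) * (((q + (∑ c ∈ s, f c) + j * k - 1).factorial : ℕ) : ℚ) /
        (j.factorial * (k.factorial : ℚ) ^ j * q.factorial * S) := by
    intro j
    rw [map_sum, ← hsum, sum_mul, sum_div]
    refine sum_congr rfl fun c hc => ?_
    have h0 := hfil c hc
    have hfc : (f c : ℚ) ≠ 0 := by
      have := (mem_filter.1 hc).2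
      exact_mod_cast this.ne'
    rw [localSeries, coeff_mk,
      show q + ((∑ c ∈ s, f c) - 1) + j * k = q + (∑ c ∈ s, f c) + j * k - 1 by omega]
    field_simp
  generalize (∑ c ∈ s, f c) = R at *
  have hX : ∀ j : ℕ, coeff j (X * localSeries k (q + 1) (R + (k - 1)) (S * (k - 1).factorial)) =
      ((j * k : ℕ) : ℚ) * (((q + R + j * k - 1).factorial : ℕ) : ℚ) /
        (j.factorial * (k.factorial : ℚ) ^ j * q.factorial * S) := by
    intro j
    cases j with
    | zero => simp
    | succ j =>
      obtain ⟨k, rfl⟩ : ∃ m, k = m + 1 := ⟨k - 1, by omega⟩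
      rw [coeff_succ_X_mul, localSeries, coeff_mk,
        show q + R + (j + 1) * (k + 1) - 1 = q + (R + (k + 1 - 1)) + j * (k + 1) by
          rw [add_mul]; omega]
      have h1 : ((k + 1).factorial : ℚ) = (k + 1) * k.factorial := by
        rw [Nat.factorial_succ]; push_cast; ring
      have h2 : ((j + 1).factorial : ℚ) = (j + 1) * j.factorial := by
        rw [Nat.factorial_succ]; push_cast; ring
      have h3 : (k.factorial : ℚ) ≠ 0 := by exact_mod_cast k.factorial_ne_zero
      have h4 : (j.factorial : ℚ) ≠ 0 := by exact_mod_cast j.factorial_ne_zero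
      have h5 : (q.factorial : ℚ) ≠ 0 := by exact_mod_cast q.factorial_ne_zero
      have h6 : (k + 1 : ℚ) ≠ 0 := by positivity
      have h7 : (j + 1 : ℚ) ≠ 0 := by positivity
      rw [pow_succ, h2, h1]
      simp only [Nat.add_sub_cancel]
      push_cast
      field_simp
  -- The conditionals isolate the case where only the final letter remains: there `localSeries k 0`
  -- has constant term 1 and ignores `S`.
  have hq : ∀ j : ℕ, coeff j (localSeries k q R S) =
      (if q + R + j * k = 0 then 1 else
        (q : ℚ) * (((q + R + j * k - 1).factorial : ℕ) : ℚ)) /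
        (j.factorial * (k.factorial : ℚ) ^ j * q.factorial * (if q + R + j * k = 0 then 1 else S)) := by
    intro j
    cases q with
    | zero =>
      rw [localSeries]
      by_cases hR : R = 0
      · subst hR
        rcases Nat.eq_zero_or_pos j with rfl | hj
        · simp
        · have : j * k ≠ 0 := (Nat.mul_pos hj hk).ne'
          simp [coeff_one, hj.ne', show k ≠ 0 by omega]
      · simp [hR]
    | succ q =>
      rw [localSeries, coeff_mk, if_neg (by omega), if_neg (by omega),
        show q + 1 + R + j * k - 1 = q + R + j * k by omega]
      have h2 : ((q + 1).factorial : ℚ) = (q + 1) * q.factorial := by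
        rw [Nat.factorial_succ]; push_cast; ring
      have h7 : (q + 1 : ℚ) ≠ 0 := by positivity
      rw [h2]
      push_cast
      field_simp
  ext j
  rw [map_add, map_add, hterm, hX, hq]
  have h0 : coeff j (localSeries k (q + 1) R S) = ((q + R + j * k).factorial : ℚ) /
    (j.factorial * (k.factorial : ℚ) ^ j * q.factorial * S) := by rw [localSeries, coeff_mk]
  rw [h0]
  by_cases hT : q + R + j * k = 0
  · obtain ⟨⟨rfl, rfl⟩, hj⟩ : (q = 0 ∧ R = 0) ∧ j * k = 0 := by omega
    obtain rfl : j = 0 := by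
      rcases Nat.mul_eq_zero.1 hj with h | h
      · exact h
      · omega
    simp [hRS rfl]
  · rw [if_neg hT, if_neg hT, ← add_div, ← add_div]
    congr 1
    obtain ⟨t, ht⟩ := Nat.exists_eq_succ_of_ne_zero hT
    have ht' : (q + R + j * k : ℚ) = t + 1 := by exact_mod_cast ht
    rw [ht, Nat.factorial_succ]
    simp only [Nat.add_sub_cancel, Nat.succ_eq_add_one]
    push_cast
    rw [← ht']
    ring

/-! ### Filling open slots: Lagrange inversion as a functional -/

/-- The functional that sends `X ^ s` to the number of ways in which `s` open slots can be filled
with `M` labelled vertices. -/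
noncomputable def fillSlots (k M : ℕ) (Q : ℚ⟦X⟧) : ℚ :=
  if M = 0 then coeff 0 Q else
    ((M - 1).factorial : ℚ) * coeff (M - 1) (derivative ℚ Q * childSeries k ^ M)

theorem fillSlots_add (k M : ℕ) (P Q : ℚ⟦X⟧) :
    fillSlots k M (P + Q) = fillSlots k M P + fillSlots k M Q := by
  unfold fillSlots
  split_ifs
  · simp
  · simp [add_mul, mul_add]

theorem fillSlots_zero (k M : ℕ) : fillSlots k M 0 = 0 := by
  simp [fillSlots]

theorem fillSlots_sum {ι : Type*} (k M : ℕ) (s : Finset ι) (Q : ι → ℚ⟦X⟧) :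
    fillSlots k M (∑ i ∈ s, Q i) = ∑ i ∈ s, fillSlots k M (Q i) := by
  classical
  induction s using Finset.induction_on with
  | empty => simp [fillSlots_zero]
  | insert a s ha ih => rw [sum_insert ha, sum_insert ha, fillSlots_add, ih]

theorem fillSlots_one (k M : ℕ) : fillSlots k M 1 = if M = 0 then 1 else 0 := by
  unfold fillSlots
  split_ifs <;> simp

/-- One open slot receives one of the `M` labelled vertices, whose own open slots are counted by
`childSeries k`. -/
theorem fillSlots_X_mul (k M : ℕ) (Q : ℚ⟦X⟧) :
    fillSlots k M (X * Q) = M * fillSlots k (M - 1) (childSeries k * Q) := by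
  match M with
  | 0 => simp [fillSlots]
  | 1 => simp [fillSlots, mul_comm]
  | M + 2 =>
    -- The identity reduces to comparing a coefficient of this product with the preceding
    -- coefficient of its derivative.
    have h := coeff_derivative (childSeries k ^ (M + 2) * Q) M
    simp only [fillSlots, Nat.add_sub_cancel, Derivation.leibniz, Derivation.leibniz_pow,
      derivative_X, smul_eq_mul, show M + 2 - 1 = M + 1 from rfl, Nat.factorial_succ,
      if_neg (Nat.succ_ne_zero _), mul_one] at h ⊢
    have e1 : (X * derivative ℚ Q + Q) * childSeries k ^ (M + 2) =
        X * (childSeries k ^ (M + 2) * derivative ℚ Q) + childSeries k ^ (M + 2) * Q := by ring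
    have e2 : (childSeries k * derivative ℚ Q + Q * derivative ℚ (childSeries k)) *
          childSeries k ^ (M + 1) = childSeries k ^ (M + 2) * derivative ℚ Q +
        Q * (childSeries k ^ (M + 1) * derivative ℚ (childSeries k)) := by ring
    have e3 : Q * (M + 2) • (childSeries k ^ (M + 1) * derivative ℚ (childSeries k)) =
        (M + 2) • (Q * (childSeries k ^ (M + 1) * derivative ℚ (childSeries k))) := by
      rw [mul_smul_comm]
    rw [e3, map_add, map_nsmul, nsmul_eq_mul] at h
    rw [e1, e2, map_add, map_add, coeff_succ_X_mul]
    push_cast at h ⊢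
    linear_combination -(M.factorial : ℚ) * h

end HypergraphCatalan

/-! ### States of a partial tour and the recursion for the potential -/

namespace HypergraphCatalan

open Finset PowerSeries

/-- The state of a partially performed tour: the current vertex, the vertices already seen, those
on the path from the root to the current vertex, the parents of the vertices seen so far, and for
each vertex the number of times it is still to be entered from its parent. -/
structure Exploration (V : Type*) where
  cur : V
  seen : Finset V
  active : Finset V
  parent : V → Option V
  left : V → ℕ

namespace Exploration

variable {V : Type*}

/-- The invariants of the states that occur in a tour with root `r`. -/
structure Valid (r : V) (s : Exploration V) : Prop where
  seen_of_parent : ∀ c v, s.parent c = some v → c ∈ s.seen ∧ v ∈ s.seen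
  -- A depth function certifies that the parent pointers have no cycle.
  depth : ∃ d : V → ℕ, ∀ c v, s.parent c = some v → d v < d c
  eq_root : ∀ v ∈ s.seen, s.parent v = none → v = r
  left_root : s.left r = 0
  cur_active : s.cur ∈ s.active
  active_subset : s.active ⊆ s.seen
  active_parent : ∀ v ∈ s.active, ∀ w, s.parent v = some w → w ∈ s.active
  -- Each vertex has at most one active child, and by the next condition `cur` has none, so that the
  -- active vertices form a path ending at `cur`.
  active_inj : ∀ v ∈ s.active, ∀ w ∈ s.active, s.parent v = s.parent w → v = w
  not_active_of_parent_cur : ∀ c, s.parent c = some s.cur → c ∉ s.active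

variable {r : V} {s : Exploration V}

theorem Valid.parent_ne (h : s.Valid r) {c v : V} (hc : s.parent c = some v) : c ≠ v := by
  rintro rfl
  obtain ⟨d, hd⟩ := h.depth
  exact (hd _ _ hc).false

theorem Valid.parent_ne_swap (h : s.Valid r) {c v : V} (hc : s.parent c = some v) :
    s.parent v ≠ some c := by
  intro hv
  obtain ⟨d, hd⟩ := h.depth
  exact (hd _ _ hc).asymm (hd _ _ hv)

theorem Valid.cur_seen (h : s.Valid r) : s.cur ∈ s.seen := h.active_subset h.cur_active

theorem Valid.parent_eq_none (h : s.Valid r) {c : V} (hc : c ∉ s.seen) : s.parent c = none := by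
  cases hp : s.parent c with
  | none => rfl
  | some v => exact absurd (h.seen_of_parent c v hp).1 hc

theorem Valid.parent_ne_of_not_seen (h : s.Valid r) {c : V} (hc : c ∉ s.seen) (v : V) :
    s.parent v ≠ some c := fun hp => hc (h.seen_of_parent v c hp).2

/-- The state before the first step of a tour. -/
def start (r : V) : Exploration V where
  cur := r
  seen := {r}
  active := {r}
  parent := fun _ => none
  left := fun _ => 0

theorem valid_start (r : V) : (start r).Valid r where
  seen_of_parent := by simp [start]
  depth := ⟨fun _ => 0, by simp [start]⟩
  eq_root := by simp [start]
  left_root := rfl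
  cur_active := by simp [start]
  active_subset := by simp [start]
  active_parent := by simp [start]
  active_inj := by simp [start]
  not_active_of_parent_cur := by simp [start]

variable [DecidableEq V]

/-- The number of times a vertex is still to be left towards its parent; for the root, there is one
virtual such step at the end. -/
def up (s : Exploration V) (v : V) : ℕ := s.left v + if v ∈ s.active then 1 else 0

def children [Fintype V] (s : Exploration V) (v : V) : Finset V :=
  univ.filter fun c => s.parent c = some v

/-- An upward exit without a destination. It serves both for a climb and for the virtual last step
at the root, since neither `remaining` nor `potential` depends on `cur`. -/
def retract (s : Exploration V) : Exploration V :=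
  { s with active := s.active.erase s.cur }

def climb (s : Exploration V) (b : V) : Exploration V :=
  { s.retract with cur := b }

def descend (s : Exploration V) (c : V) : Exploration V :=
  { s with
    cur := c
    active := insert c s.active
    left := Function.update s.left c (s.left c - 1) }

def discover (k : ℕ) (s : Exploration V) (c : V) : Exploration V where
  cur := c
  seen := insert c s.seen
  active := insert c s.active
  parent := Function.update s.parent c (some s.cur)
  left := Function.update s.left c (k - 1)

/-- The state after a step to `c`, if this step is allowed. -/
def next (k : ℕ) (s : Exploration V) (c : V) : Option (Exploration V) :=
  if c ∉ s.seen then some (s.discover k c)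
  else if s.parent c = some s.cur ∧ 0 < s.left c then some (s.descend c)
  else if s.parent s.cur = some c then some (s.climb c)
  else none

theorem Valid.climb (h : s.Valid r) {b : V} (hb : s.parent s.cur = some b) :
    (s.climb b).Valid r where
  seen_of_parent := h.seen_of_parent
  depth := h.depth
  eq_root := h.eq_root
  left_root := h.left_root
  cur_active := mem_erase.2 ⟨(h.parent_ne hb).symm, h.active_parent _ h.cur_active _ hb⟩
  active_subset := (erase_subset _ _).trans h.active_subset
  active_parent := fun v hv w hw => by
    have hv' := mem_erase.1 hv
    refine mem_erase.2 ⟨?_, h.active_parent v hv'.2 w hw⟩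
    rintro rfl
    exact h.not_active_of_parent_cur v hw hv'.2
  active_inj := fun v hv w hw => h.active_inj v (mem_erase.1 hv).2 w (mem_erase.1 hw).2
  not_active_of_parent_cur := fun c hc hca => by
    have hc' := mem_erase.1 hca
    exact hc'.1 (h.active_inj c hc'.2 s.cur h.cur_active (Eq.trans hc hb.symm))

theorem Valid.descend (h : s.Valid r) {c : V} (hc : s.parent c = some s.cur)
    (hr : 0 < s.left c) : (s.descend c).Valid r where
  seen_of_parent := h.seen_of_parent
  depth := h.depth
  eq_root := h.eq_root
  left_root := by
    have : r ≠ c := by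
      rintro rfl
      exact hr.ne' h.left_root
    simp [Exploration.descend, this, h.left_root]
  cur_active := mem_insert_self _ _
  active_subset := insert_subset (h.seen_of_parent _ _ hc).1 h.active_subset
  active_parent := fun v hv w hw => by
    rcases mem_insert.1 hv with rfl | hv
    · obtain rfl : s.cur = w := Option.some.inj (hc.symm.trans hw)
      exact mem_insert_of_mem h.cur_active
    · exact mem_insert_of_mem (h.active_parent v hv w hw)
  active_inj := fun v hv w hw hvw => by
    rcases mem_insert.1 hv with rfl | hv' <;> rcases mem_insert.1 hw with rfl | hw'
    · rfl
    · exact absurd hw' (h.not_active_of_parent_cur w (hvw.symm.trans hc))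
    · exact absurd hv' (h.not_active_of_parent_cur v (hvw.trans hc))
    · exact h.active_inj v hv' w hw' hvw
  not_active_of_parent_cur := fun v hv hva => by
    rcases mem_insert.1 hva with rfl | hva
    · exact h.parent_ne hv rfl
    · exact h.not_active_of_parent_cur c hc (h.active_parent v hva c hv)

theorem Valid.discover (h : s.Valid r) (k : ℕ) (hr : r ∈ s.seen) {c : V} (hc : c ∉ s.seen) :
    (s.discover k c).Valid r := by
  have hcur : s.cur ≠ c := fun e => hc (e ▸ h.cur_seen)
  have key : ∀ v w, (s.discover k c).parent v = some w ↔
      (v = c ∧ w = s.cur) ∨ (v ≠ c ∧ s.parent v = some w) := by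
    intro v w
    by_cases hv : v = c
    · subst hv
      simp [Exploration.discover, eq_comm]
    · simp [Exploration.discover, hv]
  have hact : ∀ v ∈ s.active, v ≠ c := fun v hv e => hc (e ▸ h.active_subset hv)
  refine ⟨?_, ?_, ?_, ?_, ?_, ?_, ?_, ?_, ?_⟩
  · intro v w hvw
    rcases (key v w).1 hvw with ⟨rfl, rfl⟩ | ⟨-, hp⟩
    · exact ⟨mem_insert_self _ _, mem_insert_of_mem h.cur_seen⟩
    · exact ⟨mem_insert_of_mem (h.seen_of_parent v w hp).1,
        mem_insert_of_mem (h.seen_of_parent v w hp).2⟩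
  · obtain ⟨d, hd⟩ := h.depth
    refine ⟨Function.update d c (d s.cur + 1), fun v w hvw => ?_⟩
    rcases (key v w).1 hvw with ⟨rfl, rfl⟩ | ⟨hv, hp⟩
    · simp [hcur]
    · have hw : w ≠ c := fun e => h.parent_ne_of_not_seen hc v (e ▸ hp)
      simpa [hv, hw] using hd v w hp
  · intro v hv hp
    rcases mem_insert.1 hv with rfl | hv
    · simp [Exploration.discover] at hp
    · have hvc : v ≠ c := fun e => hc (e ▸ hv)
      exact h.eq_root v hv (by simpa [Exploration.discover, hvc] using hp)
  · have : r ≠ c := fun e => hc (e ▸ hr)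
    simp [Exploration.discover, this, h.left_root]
  · exact mem_insert_self _ _
  · exact insert_subset_insert _ h.active_subset
  · intro v hv w hvw
    rcases (key v w).1 hvw with ⟨rfl, rfl⟩ | ⟨hvc, hp⟩
    · exact mem_insert_of_mem h.cur_active
    · exact mem_insert_of_mem (h.active_parent v ((mem_insert.1 hv).resolve_left hvc) w hp)
  · have hpc : (s.discover k c).parent c = some s.cur := (key _ _).2 (Or.inl ⟨rfl, rfl⟩)
    have aux : ∀ v ∈ s.active, (s.discover k c).parent v ≠ some s.cur := fun v hv hp => by
      rcases (key v _).1 hp with ⟨e, -⟩ | ⟨-, hp⟩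
      · exact hact v hv e
      · exact h.not_active_of_parent_cur v hp hv
    intro v hv w hw hvw
    rcases mem_insert.1 hv with rfl | hv' <;> rcases mem_insert.1 hw with rfl | hw'
    · rfl
    · exact absurd (hvw.symm.trans hpc) (aux w hw')
    · exact absurd (hvw.trans hpc) (aux v hv')
    · exact h.active_inj v hv' w hw' (by
        simpa [Exploration.discover, hact v hv', hact w hw'] using hvw)
  · intro v hv hva
    rcases (key v _).1 hv with ⟨-, e⟩ | ⟨-, hp⟩
    · exact hcur e.symm
    · exact h.parent_ne_of_not_seen hc v hp

theorem next_eq_some {k : ℕ} {c : V} {s' : Exploration V} (h : s.next k c = some s') :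
    (c ∉ s.seen ∧ s' = s.discover k c) ∨
      (s.parent c = some s.cur ∧ 0 < s.left c ∧ s' = s.descend c) ∨
      (s.parent s.cur = some c ∧ s' = s.climb c) := by
  unfold next at h
  by_cases h1 : c ∉ s.seen
  · rw [if_pos h1] at h
    exact Or.inl ⟨h1, (Option.some.inj h).symm⟩
  · rw [if_neg h1] at h
    split_ifs at h with h2 h3
    · exact Or.inr (Or.inl ⟨h2.1, h2.2, (Option.some.inj h).symm⟩)
    · exact Or.inr (Or.inr ⟨h3, (Option.some.inj h).symm⟩)

theorem next_discover (k : ℕ) {c : V} (hc : c ∉ s.seen) :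
    s.next k c = some (s.discover k c) := if_pos hc

theorem Valid.next_descend (h : s.Valid r) (k : ℕ) {c : V} (hc : s.parent c = some s.cur)
    (hr : 0 < s.left c) : s.next k c = some (s.descend c) := by
  rw [next, if_neg (not_not.2 (h.seen_of_parent _ _ hc).1), if_pos ⟨hc, hr⟩]

theorem Valid.next_climb (h : s.Valid r) (k : ℕ) {c : V} (hc : s.parent s.cur = some c) :
    s.next k c = some (s.climb c) := by
  rw [next, if_neg (not_not.2 (h.seen_of_parent _ _ hc).2),
    if_neg fun h' => h.parent_ne_swap hc h'.1, if_pos hc]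

theorem Valid.next (h : s.Valid r) (hr : r ∈ s.seen) {k : ℕ} {c : V} {s' : Exploration V}
    (hs : s.next k c = some s') : s'.Valid r ∧ r ∈ s'.seen := by
  rcases next_eq_some hs with ⟨hc, rfl⟩ | ⟨hc, hl, rfl⟩ | ⟨hc, rfl⟩
  · exact ⟨h.discover k hr hc, mem_insert_of_mem hr⟩
  · exact ⟨h.descend hc hl, hr⟩
  · exact ⟨h.climb hc, hr⟩

variable [Fintype V]

/-- The number of steps, including the virtual one, that are still to be made. -/
def remaining (k : ℕ) (s : Exploration V) : ℕ :=
  ∑ v ∈ s.seen, (s.left v + s.up v) + 2 * k * s.seenᶜ.card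

theorem Valid.remaining_retract (h : s.Valid r) (k : ℕ) :
    s.retract.remaining k + 1 = s.remaining k := by
  have hrest : ∑ v ∈ s.seen.erase s.cur, (s.retract.left v + s.retract.up v) =
      ∑ v ∈ s.seen.erase s.cur, (s.left v + s.up v) :=
    sum_congr rfl fun v hv => by simp [up, retract, (mem_erase.1 hv).1]
  have h1 : s.retract.remaining k = ∑ v ∈ s.seen, (s.retract.left v + s.retract.up v) +
    2 * k * s.seenᶜ.card := rfl
  rw [h1, remaining, ← add_sum_erase _ _ h.cur_seen, ← add_sum_erase s.seen _ h.cur_seen, hrest]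
  simp only [up, retract, h.cur_active, mem_erase, ne_eq, not_true_eq_false, false_and, if_false,
    if_true]
  ring

theorem Valid.remaining_climb (h : s.Valid r) (k : ℕ) (b : V) :
    (s.climb b).remaining k + 1 = s.remaining k := h.remaining_retract k

theorem Valid.remaining_descend (h : s.Valid r) (k : ℕ) {c : V} (hc : s.parent c = some s.cur)
    (hr : 0 < s.left c) : (s.descend c).remaining k + 1 = s.remaining k := by
  have hcs := (h.seen_of_parent _ _ hc).1
  have hrest : ∑ v ∈ s.seen.erase c, ((s.descend c).left v + (s.descend c).up v) =
      ∑ v ∈ s.seen.erase c, (s.left v + s.up v) :=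
    sum_congr rfl fun v hv => by simp [up, Exploration.descend, (mem_erase.1 hv).1]
  have h1 : (s.descend c).remaining k =
    ∑ v ∈ s.seen, ((s.descend c).left v + (s.descend c).up v) + 2 * k * s.seenᶜ.card := rfl
  rw [h1, remaining, ← add_sum_erase _ _ hcs, ← add_sum_erase s.seen _ hcs, hrest]
  simp [up, Exploration.descend, h.not_active_of_parent_cur c hc]
  omega

theorem remaining_discover {k : ℕ} (hk : 1 ≤ k) {c : V}
    (hc : c ∉ s.seen) : (s.discover k c).remaining k + 1 = s.remaining k := by
  have hrest : ∑ v ∈ s.seen, ((s.discover k c).left v + (s.discover k c).up v) =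
      ∑ v ∈ s.seen, (s.left v + s.up v) :=
    sum_congr rfl fun v hv => by
      have : v ≠ c := fun e => hc (e ▸ hv)
      simp [up, Exploration.discover, this]
  have h1 : (s.discover k c).remaining k =
    ∑ v ∈ insert c s.seen, ((s.discover k c).left v + (s.discover k c).up v) +
      2 * k * (insert c s.seen)ᶜ.card := rfl
  have h2 : s.seenᶜ.card = (insert c s.seen)ᶜ.card + 1 := by
    rw [compl_insert, card_erase_add_one (mem_compl.2 hc)]
  rw [h1, remaining, sum_insert hc, hrest, h2]
  simp [up, Exploration.discover]
  rw [mul_add]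
  omega

theorem Valid.remaining_next (h : s.Valid r) {k : ℕ} (hk : 1 ≤ k) {c : V} {s' : Exploration V}
    (hs : s.next k c = some s') : s'.remaining k + 1 = s.remaining k := by
  rcases next_eq_some hs with ⟨hc, rfl⟩ | ⟨hc, hl, rfl⟩ | ⟨hc, rfl⟩
  · exact remaining_discover hk hc
  · exact h.remaining_descend k hc hl
  · exact h.remaining_climb k c

noncomputable def vertexSeries (k : ℕ) (s : Exploration V) (v : V) : ℚ⟦X⟧ :=
  localSeries k (s.up v) (∑ c ∈ s.children v, s.left c)
    (∏ c ∈ s.children v, ((s.left c).factorial : ℚ))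

/-- A closed form for the number of ways to complete a partially performed tour. -/
noncomputable def potential (k : ℕ) (s : Exploration V) : ℚ :=
  fillSlots k s.seenᶜ.card (∏ v ∈ s.seen, s.vertexSeries k v)

theorem vertexSeries_congr {k : ℕ} {s' : Exploration V} {v : V} (hu : s'.up v = s.up v)
    (hc : s'.children v = s.children v) (hl : ∀ c ∈ s.children v, s'.left c = s.left c) :
    s'.vertexSeries k v = s.vertexSeries k v := by
  rw [vertexSeries, vertexSeries, hu, hc, sum_congr rfl hl,
    prod_congr rfl fun c h => by rw [hl c h]]

theorem mem_children {v c : V} : c ∈ s.children v ↔ s.parent c = some v := by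
  simp [children]

theorem Valid.potential_retract (h : s.Valid r) (k : ℕ) :
    s.retract.potential k = fillSlots k s.seenᶜ.card
      (localSeries k (s.left s.cur) (∑ c ∈ s.children s.cur, s.left c)
        (∏ c ∈ s.children s.cur, ((s.left c).factorial : ℚ)) *
        ∏ v ∈ s.seen.erase s.cur, s.vertexSeries k v) := by
  have h1 : s.retract.potential k =
    fillSlots k s.seenᶜ.card (∏ v ∈ s.seen, s.retract.vertexSeries k v) := rfl
  rw [h1, ← mul_prod_erase _ _ h.cur_seen]
  congr 2
  · have : s.retract.up s.cur = s.left s.cur := by simp [up, retract]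
    rw [vertexSeries, this]
    rfl
  · refine prod_congr rfl fun v hv => vertexSeries_congr ?_ rfl fun _ _ => rfl
    simp [up, retract, (mem_erase.1 hv).1]

theorem Valid.potential_descend (h : s.Valid r) (k : ℕ) {c : V} (hc : s.parent c = some s.cur)
    (hr : 0 < s.left c) :
    (s.descend c).potential k = fillSlots k s.seenᶜ.card
      (localSeries k (s.left s.cur + 1) (∑ c ∈ s.children s.cur, s.left c - 1)
        ((∏ c ∈ s.children s.cur, ((s.left c).factorial : ℚ)) / s.left c) *
        ∏ v ∈ s.seen.erase s.cur, s.vertexSeries k v) := by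
  have h1 : (s.descend c).potential k =
    fillSlots k s.seenᶜ.card (∏ v ∈ s.seen, (s.descend c).vertexSeries k v) := rfl
  have hne : s.cur ≠ c := (h.parent_ne hc).symm
  have hcc : c ∈ s.children s.cur := mem_children.2 hc
  rw [h1, ← mul_prod_erase _ _ h.cur_seen]
  congr 2
  · have e1 : (s.descend c).up s.cur = s.left s.cur + 1 := by
      simp [up, Exploration.descend, hne, h.cur_active]
    have e2 : (s.descend c).children s.cur = s.children s.cur := rfl
    have e3 : ∀ v ∈ (s.children s.cur).erase c, (s.descend c).left v = s.left v := fun v hv => by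
      simp [Exploration.descend, (mem_erase.1 hv).1]
    have e4 : (s.descend c).left c = s.left c - 1 := by simp [Exploration.descend]
    obtain ⟨m, hm⟩ : ∃ m, s.left c = m + 1 := ⟨s.left c - 1, by omega⟩
    rw [vertexSeries, e1, e2]
    congr 1
    · rw [← add_sum_erase _ _ hcc, ← add_sum_erase (s.children s.cur) _ hcc, sum_congr rfl e3, e4]
      exact (Nat.sub_add_comm hr).symm
    · rw [← mul_prod_erase _ _ hcc, ← mul_prod_erase (s.children s.cur) _ hcc,
        prod_congr rfl fun v hv => by rw [e3 v hv], e4, hm, Nat.factorial_succ]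
      have : (m + 1 : ℚ) ≠ 0 := by positivity
      push_cast
      field_simp
  · refine prod_congr rfl fun v hv => vertexSeries_congr ?_ rfl fun w hw => ?_
    -- Entering `c` trades one pending entry for membership in the active path, so `up c` does not
    -- change.
    · by_cases hvc : v = c
      · subst hvc
        simp [up, Exploration.descend, h.not_active_of_parent_cur v hc]
        omega
      · simp [up, Exploration.descend, hvc]
    · have : w ≠ c := by
        rintro rfl
        exact (mem_erase.1 hv).1 (Option.some.inj ((mem_children.1 hw).symm.trans hc))
      simp [Exploration.descend, this]

theorem Valid.potential_discover (h : s.Valid r) {k : ℕ} (hk : 1 ≤ k) {c : V}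
    (hc : c ∉ s.seen) :
    (s.discover k c).potential k = fillSlots k (s.seenᶜ.card - 1)
      (childSeries k * (localSeries k (s.left s.cur + 1)
        (∑ c ∈ s.children s.cur, s.left c + (k - 1))
        ((∏ c ∈ s.children s.cur, ((s.left c).factorial : ℚ)) * (k - 1).factorial) *
        ∏ v ∈ s.seen.erase s.cur, s.vertexSeries k v)) := by
  have h1 : (s.discover k c).potential k = fillSlots k (insert c s.seen)ᶜ.card
    (∏ v ∈ insert c s.seen, (s.discover k c).vertexSeries k v) := rfl
  have hne : s.cur ≠ c := fun e => hc (e ▸ h.cur_seen)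
  have hchild : ∀ v, c ∉ s.children v := fun v hv =>
    hc (h.seen_of_parent _ _ (mem_children.1 hv)).1
  have hleft : ∀ v w, w ∈ s.children v → (s.discover k c).left w = s.left w := fun v w hw => by
    have : w ≠ c := fun e => hchild v (e ▸ hw)
    simp [Exploration.discover, this]
  have hmem : ∀ v w, w ∈ (s.discover k c).children v ↔
      (w = c ∧ v = s.cur) ∨ w ∈ s.children v := by
    intro v w
    rw [mem_children, mem_children]
    by_cases hw : w = c
    · subst hw
      simp [Exploration.discover, h.parent_eq_none hc, eq_comm]
    · simp [Exploration.discover, hw]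
  rw [h1, compl_insert, card_erase_of_mem (mem_compl.2 hc), prod_insert hc,
    ← mul_prod_erase _ _ h.cur_seen]
  have hlc : (s.discover k c).left c = k - 1 := by simp [Exploration.discover]
  congr 3
  · have e1 : (s.discover k c).up c = k := by
      simp [up, Exploration.discover]; omega
    have e2 : (s.discover k c).children c = ∅ := by
      ext w
      rw [hmem, mem_children]
      simp [hne.symm, h.parent_ne_of_not_seen hc w]
    rw [vertexSeries, e1, e2, childSeries]
    simp
  · have e1 : (s.discover k c).up s.cur = s.left s.cur + 1 := by
      simp [up, Exploration.discover, hne, h.cur_active]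
    have e2 : (s.discover k c).children s.cur = insert c (s.children s.cur) := by
      ext w
      rw [hmem, mem_insert]
      simp
    rw [vertexSeries, e1, e2, sum_insert (hchild _), prod_insert (hchild _), hlc,
      sum_congr rfl (hleft s.cur), prod_congr rfl fun w hw => by rw [hleft s.cur w hw],
      add_comm (k - 1), mul_comm ((k - 1).factorial : ℚ)]
  · refine prod_congr rfl fun v hv => vertexSeries_congr ?_ ?_ (hleft v)
    · have : v ≠ c := fun e => hc (e ▸ (mem_erase.1 hv).2)
      simp [up, Exploration.discover, this]
    · ext w
      rw [hmem]
      simp [(mem_erase.1 hv).1]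

/-- Only the factor of the current vertex needs expanding, by `localSeries_succ`. Its `X` term opens
a slot, and `fillSlots_X_mul` turns this into equal contributions from all unseen vertices. -/
theorem Valid.potential_eq (h : s.Valid r) {k : ℕ} (hk : 1 ≤ k) :
    s.potential k = s.retract.potential k +
      ∑ c ∈ (s.children s.cur).filter (fun c => 0 < s.left c), (s.descend c).potential k +
      ∑ c ∈ s.seenᶜ, (s.discover k c).potential k := by
  have hup : s.up s.cur = s.left s.cur + 1 := by simp [up, h.cur_active]
  rw [potential, ← mul_prod_erase _ _ h.cur_seen, vertexSeries, hup, localSeries_succ hk,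
    add_mul, add_mul, fillSlots_add, fillSlots_add, h.potential_retract, sum_mul, fillSlots_sum]
  congr 1
  · congr 1
    refine sum_congr rfl fun c hc => ?_
    obtain ⟨hc, hr⟩ := mem_filter.1 hc
    rw [h.potential_descend k (mem_children.1 hc) hr]
  · rw [mul_assoc, fillSlots_X_mul, sum_congr rfl fun c hc =>
      h.potential_discover hk (mem_compl.1 hc), sum_const, nsmul_eq_mul]

end Exploration

end HypergraphCatalan

/-! ### Terminal states and the number of allowed step sequences -/

namespace HypergraphCatalan

open Finset PowerSeries

namespace Exploration

variable {V : Type*} {r : V} {s : Exploration V}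

/-- Another active vertex of least depth would have an active parent of smaller depth, necessarily
`cur`; but no child of `cur` is active. -/
theorem Valid.active_eq_of_parent_cur (h : s.Valid r) (hp : s.parent s.cur = none) :
    s.active = {s.cur} := by
  classical
  refine eq_singleton_iff_unique_mem.2 ⟨h.cur_active, fun v hv => ?_⟩
  by_contra hne
  obtain ⟨d, hd⟩ := h.depth
  obtain ⟨w, hw, hmin⟩ := (s.active.erase s.cur).exists_min_image d
    ⟨v, mem_erase.2 ⟨hne, hv⟩⟩
  obtain ⟨hwc, hwa⟩ := mem_erase.1 hw
  cases hpw : s.parent w with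
  | none => exact hwc (h.active_inj w hwa _ h.cur_active (hpw.trans hp.symm))
  | some b =>
    have hb := h.active_parent w hwa b hpw
    by_cases hbc : b = s.cur
    · exact h.not_active_of_parent_cur w (hbc ▸ hpw) hwa
    · exact (hmin b (mem_erase.2 ⟨hbc, hb⟩)).not_gt (hd w b hpw)

variable [DecidableEq V] [Fintype V]

theorem Valid.of_remaining_eq_one (h : s.Valid r) {k : ℕ} (hk : 1 ≤ k)
    (hs : s.remaining k = 1) :
    s.cur = r ∧ s.parent s.cur = none ∧ s.seenᶜ = ∅ ∧ (∀ v, s.left v = 0) ∧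
      ∀ v, v ≠ r → s.up v = 0 := by
  have h0 : s.retract.remaining k = 0 := by
    have := h.remaining_retract k
    omega
  have h1 : ∑ v ∈ s.seen, (s.retract.left v + s.retract.up v) + 2 * k * s.seenᶜ.card = 0 := h0
  obtain ⟨h2, h3⟩ := Nat.add_eq_zero_iff.1 h1
  have hcompl : s.seenᶜ = ∅ := by
    rcases Nat.mul_eq_zero.1 h3 with h4 | h4
    · omega
    · exact card_eq_zero.1 h4
  have hseen : ∀ v, v ∈ s.seen := fun v => by
    by_contra hv
    have := mem_compl.2 hv
    rw [hcompl] at this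
    simp at this
  have h5 : ∀ v, s.left v = 0 ∧ s.retract.up v = 0 := fun v =>
    Nat.add_eq_zero_iff.1 (sum_eq_zero_iff.1 h2 v (hseen v))
  have hact : ∀ v ∈ s.active, v = s.cur := fun v hv => by
    by_contra hne
    have := (h5 v).2
    simp [up, retract, hne, hv] at this
  have hp : s.parent s.cur = none := by
    cases hb : s.parent s.cur with
    | none => rfl
    | some b =>
      exact absurd (hact b (h.active_parent _ h.cur_active b hb)) (h.parent_ne hb).symm
  have hc := h.eq_root _ h.cur_seen hp
  refine ⟨hc, hp, hcompl, fun v => (h5 v).1, fun v hv => ?_⟩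
  have : v ∉ s.active := fun hva => hv ((hact v hva).trans hc)
  simp [up, this, (h5 v).1]

/-- The virtual last step must come at the very end. If entries are still pending, take a vertex of
least depth with `left` nonzero: its parent will never be exited upwards again, yet owes exits to a
child, so the parent's local series is zero. If none are pending, all series are 1 and unseen
vertices cannot be placed. -/
theorem Valid.potential_retract_root (h : s.Valid r) {k : ℕ} (hk : 1 ≤ k)
    (hp : s.parent s.cur = none) :
    s.retract.potential k = if s.remaining k = 1 then 1 else 0 := by
  have hup : ∀ v, s.retract.up v = s.left v := fun v => by
    simp [up, retract, h.active_eq_of_parent_cur hp]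
  have hrem := h.remaining_retract k
  have hrem' : s.retract.remaining k =
      ∑ v ∈ s.seen, (s.left v + s.retract.up v) + 2 * k * s.seenᶜ.card := rfl
  have hpot : s.retract.potential k =
    fillSlots k s.seenᶜ.card (∏ v ∈ s.seen, s.retract.vertexSeries k v) := rfl
  by_cases hall : ∀ v ∈ s.seen, s.left v = 0
  · have hprod : ∏ v ∈ s.seen, s.retract.vertexSeries k v = 1 := by
      refine prod_eq_one fun v hv => ?_
      have : ∑ c ∈ s.retract.children v, s.retract.left c = 0 :=
        sum_eq_zero fun c hc => hall c (h.seen_of_parent _ _ (mem_children.1 hc)).1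
      rw [vertexSeries, hup, hall v hv, this, localSeries, if_pos rfl]
    have hz : ∑ v ∈ s.seen, (s.left v + s.retract.up v) = 0 :=
      sum_eq_zero fun v hv => by simp [hup, hall v hv]
    rw [hpot, hprod, fillSlots_one, ← hrem, hrem', hz, zero_add]
    congr 1
    have : 2 * k ≠ 0 := by omega
    simp [show k ≠ 0 by omega]
  · push Not at hall
    obtain ⟨d, hd⟩ := h.depth
    obtain ⟨v0, hv0, hl0⟩ := hall
    obtain ⟨v, hv, hmin⟩ := (s.seen.filter fun v => s.left v ≠ 0).exists_min_image d
      ⟨v0, mem_filter.2 ⟨hv0, hl0⟩⟩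
    obtain ⟨hvs, hvl⟩ := mem_filter.1 hv
    have hz : s.remaining k ≠ 1 := by
      have : s.left v + s.retract.up v ≤ ∑ v ∈ s.seen, (s.left v + s.retract.up v) :=
        single_le_sum (f := fun v => s.left v + s.retract.up v) (fun _ _ => Nat.zero_le _) hvs
      omega
    rw [if_neg hz, hpot]
    cases hpv : s.parent v with
    | none => exact absurd (h.eq_root v hvs hpv ▸ h.left_root) hvl
    | some w =>
      have hws := (h.seen_of_parent v w hpv).2
      have hwl : s.left w = 0 := by
        by_contra hne
        exact (hmin w (mem_filter.2 ⟨hws, hne⟩)).not_gt (hd v w hpv)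
      have hsum : ∑ c ∈ s.retract.children w, s.retract.left c ≠ 0 := fun h0 =>
        hvl (sum_eq_zero_iff.1 h0 v (mem_children.2 hpv))
      rw [prod_eq_zero hws, fillSlots_zero]
      rw [vertexSeries, hup, hwl, localSeries, if_neg hsum]

/-- The sequences of `m` steps that are allowed from a given state. -/
def runs (k : ℕ) : ℕ → Exploration V → Finset (List V)
  | 0, _ => {[]}
  | m + 1, s => univ.biUnion fun c => (s.next k c).elim ∅ fun s' => (runs k m s').image (c :: ·)

theorem nil_mem_runs {k : ℕ} : [] ∈ runs k 0 s := mem_singleton_self _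

theorem cons_mem_runs {k m : ℕ} {c : V} {w : List V} :
    c :: w ∈ runs k (m + 1) s ↔ ∃ s', s.next k c = some s' ∧ w ∈ runs k m s' := by
  rw [runs, mem_biUnion]
  constructor
  · rintro ⟨c', -, h⟩
    cases hn : s.next k c' with
    | none => simp [hn] at h
    | some s' =>
      simp only [hn, Option.elim_some, mem_image, List.cons.injEq] at h
      obtain ⟨w', hw', rfl, rfl⟩ := h
      exact ⟨s', hn, hw'⟩
  · rintro ⟨s', hn, hw⟩
    exact ⟨c, mem_univ _, by simpa [hn] using hw⟩

theorem length_of_mem_runs {k m : ℕ} {w : List V} (h : w ∈ runs k m s) : w.length = m := by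
  induction m generalizing s w with
  | zero => simp_all [runs]
  | succ m ih =>
    cases w with
    | nil =>
      rw [runs, mem_biUnion] at h
      obtain ⟨c, -, h⟩ := h
      cases hn : s.next k c <;> simp [hn] at h
    | cons c w =>
      obtain ⟨s', -, hw⟩ := cons_mem_runs.1 h
      simp [ih hw]

theorem card_runs_succ (k m : ℕ) (s : Exploration V) :
    (runs k (m + 1) s).card = ∑ c, (s.next k c).elim 0 fun s' => (runs k m s').card := by
  rw [runs, card_biUnion]
  · refine sum_congr rfl fun c _ => ?_
    cases s.next k c with
    | none => rfl
    | some s' => exact card_image_of_injective _ (List.cons_injective)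
  · intro c _ c' _ hcc
    refine disjoint_left.2 fun w hw hw' => ?_
    cases hn : s.next k c with
    | none => simp [hn] at hw
    | some s' =>
      cases hn' : s.next k c' with
      | none => simp [hn'] at hw'
      | some s'' =>
        simp only [hn, hn', Option.elim_some, mem_image] at hw hw'
        obtain ⟨u, -, rfl⟩ := hw
        obtain ⟨u', -, hu⟩ := hw'
        exact hcc (List.cons.inj hu).1.symm

/-- The `retract` term of `Valid.potential_eq` is the climb when `cur` has a parent, and vanishes at
the root before the last step. -/
theorem Valid.sum_next (h : s.Valid r) {k : ℕ} (hk : 1 ≤ k) (hs : s.remaining k ≠ 1) :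
    ∑ c, (s.next k c).elim 0 (fun s' => s'.potential k) = s.potential k := by
  rw [h.potential_eq hk, ← sum_add_sum_compl s.seen]
  have hsub : (s.children s.cur).filter (fun c => 0 < s.left c) ⊆ s.seen := fun c hc =>
    (h.seen_of_parent _ _ (mem_children.1 (mem_filter.1 hc).1)).1
  congr 1
  · have hfil : ∑ c ∈ (s.children s.cur).filter (fun c => 0 < s.left c),
        (s.descend c).potential k = ∑ c ∈ (s.children s.cur).filter (fun c => 0 < s.left c),
        (s.next k c).elim 0 (fun s' => s'.potential k) := sum_congr rfl fun c hc => by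
      obtain ⟨hc, hr⟩ := mem_filter.1 hc
      rw [h.next_descend k (mem_children.1 hc) hr, Option.elim_some]
    have hnone : ∀ c ∈ s.seen, s.parent s.cur ≠ some c →
        c ∉ (s.children s.cur).filter (fun c => 0 < s.left c) →
        (s.next k c).elim 0 (fun s' => s'.potential k) = 0 := by
      intro c hc hpc hcf
      cases hn : s.next k c with
      | none => rfl
      | some s' =>
        rcases next_eq_some hn with ⟨hc', -⟩ | ⟨hp, hl, -⟩ | ⟨hp, -⟩
        · exact absurd hc hc'
        · exact absurd (mem_filter.2 ⟨mem_children.2 hp, hl⟩) hcf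
        · exact absurd hp hpc
    rw [hfil]
    cases hp : s.parent s.cur with
    | none =>
      rw [h.potential_retract_root hk hp, if_neg hs, zero_add]
      exact (sum_subset hsub fun c hc hcf => hnone c hc (by simp [hp]) hcf).symm
    | some b =>
      have hb := (h.seen_of_parent _ _ hp).2
      have hbf : b ∉ (s.children s.cur).filter (fun c => 0 < s.left c) := fun hb =>
        h.parent_ne_swap hp (mem_children.1 (mem_filter.1 hb).1)
      rw [← add_sum_erase _ _ hb, h.next_climb k hp, Option.elim_some]
      congr 1
      refine (sum_subset (fun c hc => mem_erase.2 ⟨fun e : c = b => hbf (e ▸ hc), hsub hc⟩)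
        fun c hc hcf => hnone c (mem_erase.1 hc).2 ?_ hcf).symm
      rw [hp]
      exact fun e => (mem_erase.1 hc).1 (Option.some.inj e).symm
  · refine sum_congr rfl fun c hc => ?_
    rw [next_discover k (mem_compl.1 hc), Option.elim_some]

theorem Valid.card_runs (h : s.Valid r) (hr : r ∈ s.seen) {k : ℕ} (hk : 1 ≤ k) {m : ℕ}
    (hm : s.remaining k = m + 1) : ((runs k m s).card : ℚ) = s.potential k := by
  induction m generalizing s with
  | zero =>
    obtain ⟨-, hp, hc, hl, -⟩ := h.of_remaining_eq_one hk hm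
    rw [h.potential_eq hk, h.potential_retract_root hk hp, if_pos hm, hc]
    simp [runs, hl]
  | succ m ih =>
    rw [← h.sum_next hk (by omega), card_runs_succ]
    push_cast
    refine sum_congr rfl fun c _ => ?_
    cases hn : s.next k c with
    | none => simp
    | some s' =>
      have h' := h.next hr hn
      have := h.remaining_next hk hn
      exact ih h'.1 h'.2 (by omega)

theorem remaining_start (k : ℕ) (r : V) :
    (start r).remaining k = 2 * k * (Fintype.card V - 1) + 1 := by
  have : (start r).remaining k =
    ∑ v ∈ {r}, ((start r).left v + (start r).up v) + 2 * k * ({r} : Finset V)ᶜ.card := rfl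
  rw [this, card_compl]
  simp [up, start]
  ring

theorem card_runs_start {k : ℕ} (hk : 1 ≤ k) (r : V) :
    ((runs k (2 * k * (Fintype.card V - 1)) (start r)).card : ℚ) =
      fillSlots k (Fintype.card V - 1) (localSeries k 1 0 1) := by
  rw [(valid_start r).card_runs (mem_singleton_self r) hk (remaining_start k r)]
  have h1 : (start r).potential k = fillSlots k ({r} : Finset V)ᶜ.card
    (∏ v ∈ {r}, (start r).vertexSeries k v) := rfl
  have h2 : (start r).children r = ∅ := by ext; simp [children, start]
  have h3 : (start r).up r = 1 := by simp [up, start]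
  rw [h1, prod_singleton, vertexSeries, h2, h3, card_compl]
  simp

end Exploration

end HypergraphCatalan

/-! ### Allowed step sequences are exactly the tours -/

namespace HypergraphCatalan

open Finset

theorem isTreeWalk_iff {V : Type*} {v : V} {W : (⊤ : SimpleGraph V).Walk v v}
    (hW : W.toSubgraph.IsSpanning) : IsTreeWalk W ↔ W.toSubgraph.spanningCoe.IsTree :=
  (SimpleGraph.Iso.isTree_iff (W.toSubgraph.spanningCoeEquivCoeOfSpanning hW)).symm

theorem spanningCoe_adj_iff {V : Type*} {u v x y : V} (W : (⊤ : SimpleGraph V).Walk u v) :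
    W.toSubgraph.spanningCoe.Adj x y ↔ s(x, y) ∈ W.edges := by
  rw [SimpleGraph.Subgraph.spanningCoe_adj, ← SimpleGraph.Subgraph.mem_edgeSet,
    SimpleGraph.Walk.mem_edges_toSubgraph]

/-- A step of a walk along a forest to a vertex that was seen before repeats an edge. -/
theorem mem_edges_of_isAcyclic {V : Type*} {r a c : V} {H : SimpleGraph V} (hH : H.IsAcyclic)
    (p : (⊤ : SimpleGraph V).Walk r a) (hp : ∀ e ∈ p.edges, e ∈ H.edgeSet) (hc : c ∈ p.support)
    (hac : H.Adj a c) : s(a, c) ∈ p.edges := by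
  classical
  -- Every edge of a forest is a bridge, so the portion of `p` between `c` and `a` must cross `s(a,
  -- c)`.
  have hb := SimpleGraph.isAcyclic_iff_forall_adj_isBridge.1 hH hac
  have hsub : ∀ e ∈ (p.dropUntil c hc).reverse.edges, e ∈ p.edges := fun e he => by
    rw [SimpleGraph.Walk.edges_reverse, List.mem_reverse] at he
    exact p.edges_dropUntil_subset_edges hc he
  have := SimpleGraph.isBridge_iff_forall_walk_mem_edges.1 hb
    ((p.dropUntil c hc).reverse.transfer H fun e he => hp e (hsub e he))
  rw [SimpleGraph.Walk.edges_transfer] at this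
  exact hsub _ this

namespace Exploration

open scoped Classical in
/-- The state `s` is reached after the walk `p`. -/
structure Tracks {V : Type*} (k : ℕ) {r a : V} (p : (⊤ : SimpleGraph V).Walk r a)
    (s : Exploration V) : Prop where
  valid : s.Valid r
  cur : s.cur = a
  seen : ∀ v, v ∈ s.seen ↔ v ∈ p.support
  -- Crossings made, entries pending and exits pending add up to the prescribed total for the edge.
  count : ∀ c v, s.parent c = some v → p.edges.count s(c, v) + s.left c + s.up c = 2 * k
  edges : ∀ e ∈ p.edges, ∃ c v, s.parent c = some v ∧ e = s(c, v)

variable {V : Type*} {k : ℕ} {r a : V} {p : (⊤ : SimpleGraph V).Walk r a} {s : Exploration V}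

theorem Tracks.root_seen (h : Tracks k p s) : r ∈ s.seen := (h.seen r).2 p.start_mem_support

theorem tracks_start (k : ℕ) (r : V) :
    Tracks k (SimpleGraph.Walk.nil : (⊤ : SimpleGraph V).Walk r r) (start r) where
  valid := valid_start r
  cur := rfl
  seen := by simp [start]
  count := by simp [start]
  edges := by simp

open scoped Classical in
theorem Tracks.next (h : Tracks k p s) (hk : 1 ≤ k) {c : V} {s' : Exploration V}
    (hn : s.next k c = some s') :
    ∃ hac : (⊤ : SimpleGraph V).Adj a c, Tracks k (p.concat hac) s' := by
  obtain ⟨hv', -⟩ := h.valid.next h.root_seen hn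
  have hv := h.valid
  obtain rfl := h.cur
  rcases next_eq_some hn with ⟨hc, rfl⟩ | ⟨hc, hl, rfl⟩ | ⟨hc, rfl⟩
  · have hne : s.cur ≠ c := fun e => hc (e ▸ hv.cur_seen)
    have hpc : (s.discover k c).parent c = some s.cur := by simp [discover]
    have hpx : ∀ x, x ≠ c → (s.discover k c).parent x = s.parent x := fun x hx => by
      simp [discover, hx]
    have hparent : ∀ x, s.parent x ≠ some c := hv.parent_ne_of_not_seen hc
    refine ⟨hne, hv', rfl, fun x => ?_, fun x y hxy => ?_, fun e he => ?_⟩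
    · rw [SimpleGraph.Walk.support_concat, List.mem_append, ← h.seen x]
      simp [discover, or_comm]
    · rw [SimpleGraph.Walk.edges_concat, List.concat_eq_append, List.count_append]
      by_cases hx : x = c
      · subst hx
        obtain rfl : s.cur = y := Option.some.inj (hpc.symm.trans hxy)
        have h0 : p.edges.count s(x, s.cur) = 0 := List.count_eq_zero.2 fun he =>
          hc ((h.seen x).2 (p.fst_mem_support_of_mem_edges he))
        rw [h0]
        simp [discover, up, Sym2.eq_swap]
        omega
      · rw [hpx x hx] at hxy
        have hyc : y ≠ c := fun e => hparent x (e ▸ hxy)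
        have h1 : s(s.cur, c) ≠ s(x, y) := fun e => by
          rcases Sym2.eq_iff.1 e with ⟨-, e⟩ | ⟨-, e⟩
          · exact hyc e.symm
          · exact hx e.symm
        have := h.count x y hxy
        rw [List.count_singleton, if_neg (by simpa using h1)]
        simpa [discover, up, hx] using this
    · rw [SimpleGraph.Walk.edges_concat, List.concat_eq_append, List.mem_append,
        List.mem_singleton] at he
      rcases he with he | rfl
      · obtain ⟨x, y, hxy, rfl⟩ := h.edges e he
        have hx : x ≠ c := fun e => hc (e ▸ (hv.seen_of_parent x y hxy).1)
        exact ⟨x, y, (hpx x hx).trans hxy, rfl⟩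
      · exact ⟨c, s.cur, hpc, Sym2.eq_swap⟩
  · have hne : s.cur ≠ c := (hv.parent_ne hc).symm
    refine ⟨hne, hv', rfl, fun x => ?_, fun x y hxy => ?_, fun e he => ?_⟩
    · rw [SimpleGraph.Walk.support_concat, List.mem_append, ← h.seen x,
        List.mem_singleton]
      exact ⟨Or.inl, fun hx => hx.elim id fun e => e ▸ (hv.seen_of_parent _ _ hc).1⟩
    · have hxy' : s.parent x = some y := hxy
      have hcount := h.count x y hxy'
      rw [SimpleGraph.Walk.edges_concat, List.concat_eq_append, List.count_append]
      by_cases hx : x = c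
      · subst hx
        obtain rfl : s.cur = y := Option.some.inj (hc.symm.trans hxy')
        have hna := hv.not_active_of_parent_cur x hc
        simp [up, hna] at hcount
        simp [descend, up, Sym2.eq_swap]
        omega
      · have h1 : s(s.cur, c) ≠ s(x, y) := fun e => by
          rcases Sym2.eq_iff.1 e with ⟨e1, e2⟩ | ⟨-, e⟩
          · exact hv.parent_ne_swap hc (by rw [e1, e2]; exact hxy')
          · exact hx e.symm
        rw [List.count_singleton, if_neg (by simpa using h1)]
        simpa [descend, up, hx] using hcount
    · rw [SimpleGraph.Walk.edges_concat, List.concat_eq_append, List.mem_append,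
        List.mem_singleton] at he
      rcases he with he | rfl
      · exact h.edges e he
      · exact ⟨c, s.cur, hc, Sym2.eq_swap⟩
  · have hne : s.cur ≠ c := hv.parent_ne hc
    refine ⟨hne, hv', rfl, fun x => ?_, fun x y hxy => ?_, fun e he => ?_⟩
    · rw [SimpleGraph.Walk.support_concat, List.mem_append, ← h.seen x,
        List.mem_singleton]
      exact ⟨Or.inl, fun hx => hx.elim id fun e => e ▸ (hv.seen_of_parent _ _ hc).2⟩
    · have hxy' : s.parent x = some y := hxy
      have hcount := h.count x y hxy'
      rw [SimpleGraph.Walk.edges_concat, List.concat_eq_append, List.count_append]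
      by_cases hx : x = s.cur
      · subst hx
        obtain rfl : c = y := Option.some.inj (hc.symm.trans hxy')
        simp [up, hv.cur_active] at hcount
        simp [climb, retract, up]
        omega
      · have h1 : s(s.cur, c) ≠ s(x, y) := fun e => by
          rcases Sym2.eq_iff.1 e with ⟨e, -⟩ | ⟨e1, e2⟩
          · exact hx e.symm
          · exact hv.parent_ne_swap hc (by rw [e1, e2]; exact hxy')
        rw [List.count_singleton, if_neg (by simpa using h1)]
        simpa [climb, retract, up, hx] using hcount
    · rw [SimpleGraph.Walk.edges_concat, List.concat_eq_append, List.mem_append,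
        List.mem_singleton] at he
      rcases he with he | rfl
      · exact h.edges e he
      · exact ⟨s.cur, c, hc, rfl⟩

variable [Fintype V]

open scoped Classical in
theorem Tracks.exists_walk (h : Tracks k p s) (hk : 1 ≤ k) {m : ℕ} {w : List V}
    (hw : w ∈ runs k m s) :
    ∃ (b : V) (q : (⊤ : SimpleGraph V).Walk r b) (s' : Exploration V),
      q.support = p.support ++ w ∧ Tracks k q s' ∧ s'.remaining k + m = s.remaining k := by
  induction w generalizing a s m with
  | nil =>
    obtain rfl : 0 = m := length_of_mem_runs hw
    exact ⟨a, p, s, by simp, h, rfl⟩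
  | cons c w ih =>
    obtain rfl : w.length + 1 = m := length_of_mem_runs hw
    obtain ⟨s₁, hs₁, hw⟩ := cons_mem_runs.1 hw
    obtain ⟨hac, h₁⟩ := h.next hk hs₁
    obtain ⟨b, q, s', hq, hs', hr⟩ := ih h₁ hw
    have := h.valid.remaining_next hk hs₁
    refine ⟨b, q, s', ?_, hs', by omega⟩
    rw [hq, SimpleGraph.Walk.support_concat]
    simp

open scoped Classical in
-- After the full number of steps only the virtual one remains: the walk is back at the root, every
-- vertex is seen and no crossing is pending, so each edge has been crossed `2 * k` times. The
-- traversed graph is connected with all edges joining a vertex to its parent, hence a tree by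
-- counting edges.
theorem exists_tour_of_mem_runs (hk : 1 ≤ k) {w : List V}
    (hw : w ∈ runs k (2 * k * (Fintype.card V - 1)) (start r)) :
    ∃ q : (⊤ : SimpleGraph V).Walk r r, q.support = r :: w ∧ IsKTour k q ∧
      q.toSubgraph.IsSpanning := by
  obtain ⟨b, q, s, hq, hs, hr⟩ := (tracks_start k r).exists_walk hk hw
  rw [remaining_start] at hr
  obtain ⟨hcur, hnone, hseen, hleft, hup⟩ := hs.valid.of_remaining_eq_one hk (by omega)
  obtain rfl : b = r := hs.cur.symm.trans hcur
  have hroot : ∀ c v, s.parent c = some v → c ≠ b := by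
    rintro c v hcv rfl
    rw [hcur, hcv] at hnone
    exact Option.some_ne_none _ hnone
  have hspan : q.toSubgraph.IsSpanning := fun v => by
    rw [SimpleGraph.Walk.mem_verts_toSubgraph, ← hs.seen, ← not_not (a := v ∈ s.seen),
      ← mem_compl, hseen]
    simp
  refine ⟨q, by simpa using hq, ⟨(isTreeWalk_iff hspan).2 ?_, fun e he => ?_⟩, hspan⟩
  · have hconn : q.toSubgraph.spanningCoe.Connected :=
      (SimpleGraph.Iso.connected_iff (q.toSubgraph.spanningCoeEquivCoeOfSpanning hspan)).2
        q.toSubgraph_connected.coe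
    refine SimpleGraph.isTree_iff_connected_and_card.2 ⟨hconn, le_antisymm ?_
      hconn.card_vert_le_card_edgeSet_add_one⟩
    -- The default `b` is harmless: each edge comes from a vertex `c` that has a parent.
    have hsub : q.toSubgraph.spanningCoe.edgeSet ⊆
        ((univ.erase b).image fun c => s(c, (s.parent c).getD b) : Finset (Sym2 V)) := by
      intro e
      induction e with
      | _ x y =>
        intro he
        obtain ⟨c, v, hcv, hxy⟩ := hs.edges _ ((spanningCoe_adj_iff q).1 he)
        rw [hxy, mem_coe, mem_image]
        refine ⟨c, mem_erase.2 ⟨hroot c v hcv, mem_univ _⟩, by simp [hcv]⟩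
    have h1 := Nat.card_mono (Finset.finite_toSet _) hsub
    have h2 : Nat.card ((univ.erase b).image fun c => s(c, (s.parent c).getD b) : Finset (Sym2 V)) ≤
        Fintype.card V - 1 := by
      rw [Nat.card_eq_fintype_card, Fintype.card_coe]
      refine card_image_le.trans ?_
      rw [card_erase_of_mem (mem_univ _), card_univ]
    have h3 : 0 < Fintype.card V := Fintype.card_pos_iff.2 ⟨b⟩
    rw [Nat.card_eq_fintype_card (α := V)]
    have h4 : Nat.card q.toSubgraph.spanningCoe.edgeSet ≤ Fintype.card V - 1 := h1.trans h2
    omega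
  · rw [SimpleGraph.Walk.mem_edges_toSubgraph] at he
    obtain ⟨c, v, hcv, rfl⟩ := hs.edges e he
    have := hs.count c v hcv
    rwa [hleft, hup c (hroot c v hcv)] at this

open scoped Classical in
-- A walk along a forest with at most `2 * k` crossings of each edge never meets a forbidden step: a
-- step to a seen vertex repeats an edge, hence is a climb or a descent.
theorem Tracks.support_mem_runs (h : Tracks k p s) (hk : 1 ≤ k) {b : V} {H : SimpleGraph V}
    (hH : H.IsAcyclic) (q : (⊤ : SimpleGraph V).Walk a b)
    (hedges : ∀ e ∈ (p.append q).edges, e ∈ H.edgeSet)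
    (hcount : ∀ e, (p.append q).edges.count e ≤ 2 * k) :
    q.support.tail ∈ runs k q.length s := by
  induction q generalizing s with
  | nil => exact nil_mem_runs
  | @cons a c b hac q ih =>
    have hv := h.valid
    obtain rfl := h.cur
    obtain ⟨s', hs'⟩ : ∃ s', s.next k c = some s' := by
      by_cases hc : c ∈ s.seen
      · have he : s(s.cur, c) ∈ p.edges := mem_edges_of_isAcyclic hH p
          (fun e he => hedges e (by simp [SimpleGraph.Walk.edges_append, he]))
          ((h.seen c).1 hc) (hedges s(s.cur, c) (by simp [SimpleGraph.Walk.edges_append]))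
        obtain ⟨x, y, hxy, he⟩ := h.edges _ he
        rcases Sym2.eq_iff.1 he with ⟨rfl, rfl⟩ | ⟨rfl, rfl⟩
        · exact ⟨_, hv.next_climb k hxy⟩
        -- Since `c` is not active, `up c = left c`; the crossing about to be made leaves fewer than
        -- `2 * k` before it, so `left c` is positive.
        · refine ⟨_, hv.next_descend k hxy ?_⟩
          have h1 := h.count _ _ hxy
          have h2 := hcount s(c, s.cur)
          rw [SimpleGraph.Walk.edges_append, List.count_append, SimpleGraph.Walk.edges_cons,
            Sym2.eq_swap (a := s.cur), List.count_cons_self] at h2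
          rw [up, if_neg (hv.not_active_of_parent_cur c hxy)] at h1
          omega
      · exact ⟨_, next_discover k hc⟩
    obtain ⟨hac', h'⟩ := h.next hk hs'
    have := ih h' (by rwa [SimpleGraph.Walk.concat_append])
      (by rwa [SimpleGraph.Walk.concat_append])
    rw [SimpleGraph.Walk.support_cons, List.tail_cons, SimpleGraph.Walk.length_cons,
      ← SimpleGraph.Walk.cons_tail_support]
    exact cons_mem_runs.2 ⟨s', hs', this⟩

end Exploration

end HypergraphCatalan

/-! ### From labelled to unlabelled tours -/

namespace HypergraphCatalan

open Finset PowerSeries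

theorem IsKTour.length_eq {V : Type*} [Fintype V] {k : ℕ} {r : V}
    {W : (⊤ : SimpleGraph V).Walk r r} (hW : IsKTour k W) (hs : W.toSubgraph.IsSpanning) :
    W.length = 2 * k * (Fintype.card V - 1) := by
  classical
  have hT := (SimpleGraph.isTree_iff_connected_and_card.1 ((isTreeWalk_iff hs).1 hW.1)).2
  have hset : W.toSubgraph.spanningCoe.edgeSet = (W.edges.toFinset : Set (Sym2 V)) := by
    ext e
    induction e with
    | _ x y =>
      rw [SimpleGraph.mem_edgeSet, spanningCoe_adj_iff, mem_coe, List.mem_toFinset]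
  rw [hset, Nat.card_eq_fintype_card, Nat.card_eq_fintype_card] at hT
  have hcard : W.edges.toFinset.card = Fintype.card V - 1 := by
    rw [← hT, Nat.add_sub_cancel]
    exact (Fintype.card_coe _).symm
  rw [← SimpleGraph.Walk.length_edges, ← List.sum_toFinset_count_eq_length,
    sum_congr rfl fun e he => ?_, sum_const, hcard, smul_eq_mul, mul_comm]
  have := hW.2 e ((W.mem_edges_toSubgraph).2 (List.mem_toFinset.1 he))
  convert this

open scoped Classical in
theorem IsKTour.support_tail_mem_runs {V : Type*} [Fintype V] {k : ℕ} (hk : 1 ≤ k) {r : V}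
    {W : (⊤ : SimpleGraph V).Walk r r} (hW : IsKTour k W) (hs : W.toSubgraph.IsSpanning) :
    W.support.tail ∈ Exploration.runs k (2 * k * (Fintype.card V - 1)) (Exploration.start r) := by
  rw [← hW.length_eq hs]
  refine (Exploration.tracks_start k r).support_mem_runs hk
    (H := W.toSubgraph.spanningCoe) ((isTreeWalk_iff hs).1 hW.1).isAcyclic W (fun e he => ?_)
    fun e => ?_
  · induction e with
    | _ x y => exact (spanningCoe_adj_iff W).2 he
  · rw [SimpleGraph.Walk.nil_append]
    by_cases he : e ∈ W.edges
    · exact (hW.2 e (W.mem_edges_toSubgraph.2 he)).le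
    · rw [List.count_eq_zero.2 he]
      exact Nat.zero_le _

namespace LabelledKTour

variable {k n : ℕ}

theorem eq_of_support_eq {W W' : LabelledKTour k n} (h : W.walk.support = W'.walk.support) :
    W = W' := by
  obtain ⟨r, w, h1, h2⟩ := W
  obtain ⟨r', w', h1', h2'⟩ := W'
  have hr : r = r' := by
    have := congrArg List.head? h
    rw [← SimpleGraph.Walk.cons_tail_support, ← w'.cons_tail_support] at this
    exact Option.some.inj this
  subst hr
  obtain rfl := SimpleGraph.Walk.ext_support h
  rfl

theorem card_eq (hk : 1 ≤ k) (n : ℕ) :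
    (Nat.card (LabelledKTour k n) : ℚ) = (n + 1) * fillSlots k n (localSeries k 1 0 1) := by
  classical
  let f : LabelledKTour k n →
      Σ r : Fin (n + 1), {w // w ∈ Exploration.runs k (2 * k * (Fintype.card (Fin (n + 1)) - 1))
        (Exploration.start r)} := fun W =>
    ⟨W.root, W.walk.support.tail, by
      convert W.isKTour.support_tail_mem_runs hk W.spanning⟩
  have hf : Function.Bijective f := by
    constructor
    · intro W W' h
      apply eq_of_support_eq
      have h1 : W.root = W'.root := congrArg Sigma.fst h
      have h2 : W.walk.support.tail = W'.walk.support.tail :=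
        congrArg (fun x => (x.2 : List (Fin (n + 1)))) h
      rw [← SimpleGraph.Walk.cons_tail_support, ← W'.walk.cons_tail_support, h2]
      exact congrArg (· :: _) h1
    · rintro ⟨r, w, hw⟩
      obtain ⟨q, hq, h1, h2⟩ := Exploration.exists_tour_of_mem_runs hk (r := r) (w := w)
        (by convert hw)
      refine ⟨⟨r, q, h1, h2⟩, ?_⟩
      simp only [f]
      congr 1
      exact Subtype.ext (by simp [hq])
  rw [Nat.card_congr (Equiv.ofBijective f hf), Nat.card_eq_fintype_card, Fintype.card_sigma]
  push_cast
  rw [sum_congr rfl fun r _ => by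
    rw [Fintype.card_coe, Exploration.card_runs_start hk r], sum_const]
  simp

theorem exists_relabel (W : LabelledKTour k n) (σ : Equiv.Perm (Fin (n + 1))) :
    ∃ W' : LabelledKTour k n, W'.walk.support = W.walk.support.map σ := by
  classical
  let g : (⊤ : SimpleGraph (Fin (n + 1))) →g (⊤ : SimpleGraph (Fin (n + 1))) :=
    ⟨σ, fun h => σ.injective.ne h⟩
  have hsupp : (W.walk.map g).support = W.walk.support.map σ := W.walk.support_map g
  have hedges : (W.walk.map g).edges = W.walk.edges.map (Sym2.map σ) := W.walk.edges_map g
  have hinj : Function.Injective (Sym2.map σ) := Sym2.map.injective σ.injective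
  have hspan : (W.walk.map g).toSubgraph.IsSpanning := fun v => by
    rw [SimpleGraph.Walk.mem_verts_toSubgraph, hsupp, List.mem_map]
    exact ⟨σ.symm v, W.walk.mem_verts_toSubgraph.1 (W.spanning _), σ.apply_symm_apply v⟩
  refine ⟨⟨σ W.root, W.walk.map g, ⟨(isTreeWalk_iff hspan).2 ?_, fun e he => ?_⟩, hspan⟩, hsupp⟩
  · refine (SimpleGraph.Iso.isTree_iff (G := W.walk.toSubgraph.spanningCoe) ⟨σ, ?_⟩).1
      ((isTreeWalk_iff W.spanning).1 W.isKTour.1)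
    intro x y
    rw [spanningCoe_adj_iff, spanningCoe_adj_iff, hedges, ← Sym2.map_mk,
      List.mem_map_of_injective hinj]
  · rw [SimpleGraph.Walk.mem_edges_toSubgraph, hedges] at he
    obtain ⟨e, he', rfl⟩ := List.mem_map.1 he
    have := W.isKTour.2 e (W.walk.mem_edges_toSubgraph.2 he')
    rw [hedges, ← this]
    convert List.count_map_of_injective _ _ hinj _

/-- A spanning tour visits every vertex, so a relabelling is determined by the sequence it produces:
each class is a free orbit of the symmetric group. -/
theorem card_eq_mul_factorial (k n : ℕ) :
    Nat.card (LabelledKTour k n) = hypergraphCatalan k n * (n + 1).factorial := by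
  choose relabel hrelabel using exists_relabel (k := k) (n := n)
  let f : Quotient (tourSetoid k n) × Equiv.Perm (Fin (n + 1)) → LabelledKTour k n :=
    fun x => relabel x.1.out x.2
  have hq : ∀ x, Quotient.mk (tourSetoid k n) (f x) = x.1 := fun x => by
    conv_rhs => rw [← Quotient.out_eq x.1]
    exact (Quotient.sound (s := tourSetoid k n) ⟨x.2, hrelabel _ _⟩).symm
  have hf : Function.Bijective f := by
    constructor
    · rintro ⟨q, σ⟩ ⟨q', τ⟩ h
      obtain rfl : q = q' := (hq (q, σ)).symm.trans ((congrArg _ h).trans (hq (q', τ)))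
      have h1 : q.out.walk.support.map σ = q.out.walk.support.map τ := by
        rw [← hrelabel, ← hrelabel]
        exact congrArg (fun W => W.walk.support) h
      have : σ = τ := Equiv.ext fun v =>
        List.map_inj_left.1 h1 v (q.out.walk.mem_verts_toSubgraph.1 (q.out.spanning v))
      rw [this]
    · intro W
      obtain ⟨σ, hσ⟩ := Quotient.exact (Quotient.out_eq (Quotient.mk (tourSetoid k n) W))
      exact ⟨(Quotient.mk _ W, σ), eq_of_support_eq ((hrelabel _ _).trans hσ.symm)⟩
  rw [← Nat.card_congr (Equiv.ofBijective f hf), Nat.card_prod, hypergraphCatalan]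
  congr 1
  rw [Nat.card_eq_fintype_card, Fintype.card_perm, Fintype.card_fin]

end LabelledKTour

theorem hypergraphCatalan_eq {k n : ℕ} (hk : 1 ≤ k) :
    (hypergraphCatalan k n : ℚ) = fillSlots k n (localSeries k 1 0 1) / n.factorial := by
  have h1 := LabelledKTour.card_eq hk n
  rw [LabelledKTour.card_eq_mul_factorial, Nat.factorial_succ] at h1
  have h2 : (n.factorial : ℚ) ≠ 0 := by exact_mod_cast n.factorial_ne_zero
  have h3 : (n + 1 : ℚ) ≠ 0 := by positivity
  rw [eq_div_iff h2]
  push_cast at h1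
  refine mul_left_cancel₀ h3 ?_
  rw [← h1]
  ring

/-! ### Extraction of coefficients -/

theorem equalMultinomial_eq (m k : ℕ) :
    (equalMultinomial m k : ℚ) = ((m * k).factorial : ℚ) / (k.factorial : ℚ) ^ m := by
  have h := Nat.multinomial_spec (univ : Finset (Fin m)) fun _ => k
  have h1 : (k.factorial : ℚ) ^ m ≠ 0 := pow_ne_zero _ (by exact_mod_cast k.factorial_ne_zero)
  rw [eq_div_iff h1, equalMultinomial, mul_comm]
  simp only [prod_const, card_univ, Fintype.card_fin, sum_const, smul_eq_mul] at h
  exact_mod_cast h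

theorem coeff_localSeries_one (k j : ℕ) :
    coeff j (localSeries k 1 0 1) = 1 / (j.factorial : ℚ) * equalMultinomial j k := by
  rw [localSeries, coeff_mk, equalMultinomial_eq]
  have h1 : (k.factorial : ℚ) ≠ 0 := by exact_mod_cast k.factorial_ne_zero
  have h2 : (j.factorial : ℚ) ≠ 0 := by exact_mod_cast j.factorial_ne_zero
  simp
  field_simp

/-- Multiplying numerator and denominator by `(j + 1) * k` restores the final letter and makes the
parent one more block of size `k`. -/
theorem coeff_childSeries {k : ℕ} (hk : 1 ≤ k) (j : ℕ) :
    coeff j (childSeries k) =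
      1 / ((j + 1).factorial : ℚ) * equalMultinomial (j + 1) k := by
  obtain ⟨q, rfl⟩ : ∃ q, k = q + 1 := ⟨k - 1, by omega⟩
  have h1 : (q.factorial : ℚ) ≠ 0 := by exact_mod_cast q.factorial_ne_zero
  have h2 : (j.factorial : ℚ) ≠ 0 := by exact_mod_cast j.factorial_ne_zero
  have h3 : (q + 1 : ℚ) ≠ 0 := by positivity
  have h4 : (j + 1 : ℚ) ≠ 0 := by positivity
  rw [childSeries, localSeries, coeff_mk, equalMultinomial_eq,
    show (j + 1) * (q + 1) = (q + 0 + j * (q + 1)) + 1 by ring, Nat.factorial_succ,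
    Nat.factorial_succ, Nat.factorial_succ]
  push_cast
  field_simp
  ring

theorem coeff_pow_eq_sum (φ : ℚ⟦X⟧) (n m : ℕ) (N : ℕ) (hm : m < n) :
    coeff m (φ ^ N) = ∑ d ∈ (piAntidiag (univ : Finset (Fin n)) N).filter
        (fun d => ∑ i : Fin n, (i : ℕ) * d i = m),
      (Nat.multinomial univ d : ℚ) * ∏ i : Fin n, coeff (i : ℕ) φ ^ d i := by
  have htrunc : ((trunc n φ : Polynomial ℚ) : ℚ⟦X⟧) =
      ∑ i : Fin n, C (coeff (i : ℕ) φ) * X ^ (i : ℕ) := by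
    rw [Fin.sum_univ_eq_sum_range (fun i => C (coeff i φ) * (X : ℚ⟦X⟧) ^ i)]
    ext j
    rw [Polynomial.coeff_coe, coeff_trunc, map_sum]
    simp [coeff_C_mul, coeff_X_pow]
  -- Truncation at degree `n > m` does not affect this coefficient, and makes the multinomial
  -- theorem applicable.
  have h1 : coeff m (φ ^ N) = coeff m (((trunc n φ : Polynomial ℚ) : ℚ⟦X⟧) ^ N) := by
    rw [← coeff_coe_trunc_of_lt hm, ← trunc_trunc_pow, coeff_coe_trunc_of_lt hm]
  rw [h1, htrunc, sum_pow_eq_sum_piAntidiag, map_sum, sum_filter]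
  refine sum_congr rfl fun d _ => ?_
  have : ∏ i : Fin n, (C (coeff (i : ℕ) φ) * (X : ℚ⟦X⟧) ^ (i : ℕ)) ^ d i =
      C (∏ i : Fin n, coeff (i : ℕ) φ ^ d i) * X ^ (∑ i : Fin n, (i : ℕ) * d i) := by
    simp only [mul_pow, prod_mul_distrib, ← pow_mul, prod_pow_eq_pow_sum, map_prod, map_pow]
  rw [this, ← nsmul_eq_mul, map_nsmul, coeff_C_mul, coeff_X_pow, nsmul_eq_mul]
  simp only [eq_comm (a := m)]
  split_ifs <;> simp

theorem coeff_childSeries_pow {k n l : ℕ} (hk : 1 ≤ k) (hl : 1 ≤ l) (hln : l ≤ n) :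
    coeff (n - l) (childSeries k ^ n) = ∑ d ∈ degreeSequences n l,
      (Nat.multinomial univ d : ℚ) *
        ∏ i ∈ (univ : Finset (Fin n)).filter (fun i : Fin n => 1 ≤ (i : ℕ)),
          ((1 / (Nat.factorial ((i : ℕ) + 1) : ℚ)) *
            (equalMultinomial ((i : ℕ) + 1) k : ℚ)) ^ d i := by
  rw [coeff_pow_eq_sum _ n (n - l) n (by omega)]
  refine sum_congr ?_ fun d _ => ?_
  · rw [degreeSequences]
    refine filter_congr fun d _ => ?_
    rw [← Nat.cast_inj (R := ℤ)]
    push_cast [hln]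
    rfl
  · congr 1
    rw [prod_filter]
    refine prod_congr rfl fun i _ => ?_
    rw [coeff_childSeries hk]
    split_ifs with hi
    · rfl
    -- A leaf has a single exit word, so the factor for `i = 0` is 1.
    · obtain h0 : (i : ℕ) = 0 := by omega
      rw [h0, equalMultinomial_eq]
      have : (k.factorial : ℚ) ≠ 0 := by exact_mod_cast k.factorial_ne_zero
      simp [this]

/-- The factor `l` comes from differentiating `X ^ l`, and `1 / n` from `(n-1)! / n!`; the shift of
index is that of the derivative. -/
theorem fillSlots_div_factorial (k : ℕ) {n : ℕ} (hn : 1 ≤ n) (Q : ℚ⟦X⟧) :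
    fillSlots k n Q / n.factorial =
      ∑ l ∈ Icc 1 n, (l : ℚ) / n * coeff l Q * coeff (n - l) (childSeries k ^ n) := by
  obtain ⟨m, rfl⟩ : ∃ m, n = m + 1 := ⟨n - 1, by omega⟩
  have h1 : (m.factorial : ℚ) ≠ 0 := by exact_mod_cast m.factorial_ne_zero
  have h2 : (m + 1 : ℚ) ≠ 0 := by positivity
  rw [fillSlots, if_neg (Nat.succ_ne_zero m), Nat.add_sub_cancel, coeff_mul,
    Nat.sum_antidiagonal_eq_sum_range_succ_mk, Nat.factorial_succ, mul_sum, sum_div,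
    sum_bij (fun l _ => l + 1)]
  · intro l hl
    simp at hl ⊢
    omega
  · intro a _ b _ h
    simpa using h
  · intro b hb
    rw [mem_Icc] at hb
    exact ⟨b - 1, by simp; omega, by omega⟩
  · intro l hl
    rw [coeff_derivative, show m + 1 - (l + 1) = m - l by omega]
    push_cast
    field_simp

end HypergraphCatalan

theorem theorem2p1 (k n : ℕ) (hk : 1 ≤ k) (hn : 1 ≤ n) :
    (HypergraphCatalan.hypergraphCatalan k n : ℚ) =
      ∑ l ∈ Finset.Icc 1 n, ∑ d ∈ HypergraphCatalan.degreeSequences n l,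
        ((l : ℚ) / (n : ℚ)) * (Nat.multinomial Finset.univ d : ℚ) *
          ((1 / (Nat.factorial l : ℚ)) * (HypergraphCatalan.equalMultinomial l k : ℚ)) *
            ∏ i ∈ (Finset.univ : Finset (Fin n)).filter (fun i : Fin n => 1 ≤ (i : ℕ)),
              ((1 / (Nat.factorial ((i : ℕ) + 1) : ℚ)) *
                (HypergraphCatalan.equalMultinomial ((i : ℕ) + 1) k : ℚ)) ^ d i := by
  rw [HypergraphCatalan.hypergraphCatalan_eq hk, HypergraphCatalan.fillSlots_div_factorial k hn]
  refine Finset.sum_congr rfl fun l hl => ?_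
  obtain ⟨hl1, hln⟩ := Finset.mem_Icc.1 hl
  rw [HypergraphCatalan.coeff_localSeries_one, HypergraphCatalan.coeff_childSeries_pow hk hl1 hln,
    Finset.mul_sum]
  refine Finset.sum_congr rfl fun d _ => ?_
  ring
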